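/- Let $m\ge 1$ be an integer and let $U\subset\mathbb R^m$ be open. Let $\mathcal{DM}_\infty(U)$ be the space of vector fields $u\in L_\infty(U;\mathbb R^m)$ whose distributional divergence $\operatorname{div}u$ is a finite signed Radon measure on $U$. Let $\bar{\mathcal S}(U)$ be the completion, with respect to the $(m-1)$-dimensional Hausdorff measure on $U$, of the $\sigma$-algebra generated by the Suslin (analytic) subsets of $U$. For a bounded, $\bar{\mathcal S}(U)$-measurable function $f\colon U\to\mathbb R$ put $$\|f\|_{BF(U)}=\sup\Big\{\int_U f\,\mathrm d\operatorname{div}u\;:\;u\in\mathcal{DM}_\infty(U),\ \|u\|_{L_\infty(U;\mathbb R^m)}\le 1\Big\}\in[0,\infty],$$ and let $\mathcal{BF}_\infty(U)$ be the set of those $f$ for which $\|f\|_{BF(U)}<\infty$. Let $1^*=\frac{m}{m-1}\in(1,\infty]$ (so $1^*=\infty$ if $m=1$), and let $\omega_m$ be the optimal constant in the Gagliardo–Nirenberg–Sobolev inequality on $\mathbb R^m$, that is, the smallest $C\ge 0$ such that $\|\varphi\|_{L_{1^*}(\mathbb R^m)}\le C\,\|\nabla\varphi\|_{L_1(\mathbb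 R^m)}$ for all $\varphi\in C_c^\infty(\mathbb R^m)$. Then every $f\in\mathcal{BF}_\infty(U)$ belongs to $L_{1^*}(U)$ and satisfies $$\|f\|_{L_{1^*}(U)}\le\omega_m\,\|f\|_{BF(U)}.$$ -/

import Mathlib

open MeasureTheory Set
open scoped ENNReal NNReal ContDiff

noncomputable section

namespace BoundedFluct

/-- The Euclidean space `ℝᵐ`. -/
abbrev Euc (m : ℕ) : Type := EuclideanSpace ℝ (Fin m)

/-- Lebesgue measure on `U ⊆ ℝᵐ`, as a measure on the subtype. -/
abbrev leb {m : ℕ} (U : Set (Euc m)) : Measure U := Measure.comap Subtype.val volume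

/-- The σ-algebra of Suslin sets: the one generated by the Suslin (analytic) subsets of `X`. -/
@[reducible] def suslinSigma (X : Type*) [TopologicalSpace X] : MeasurableSpace X :=
  MeasurableSpace.generateFrom {s : Set X | AnalyticSet s}

/-- The completion of the σ-algebra of Suslin sets in `U ⊆ ℝᵐ` with respect to the
`(m - 1)`-dimensional Hausdorff measure on `U`: the sets that agree with a member of that
σ-algebra up to an `(m - 1)`-dimensional Hausdorff null set. -/
@[reducible] def suslinCompletion {m : ℕ} (U : Set (Euc m)) : MeasurableSpace U :=
  eventuallyMeasurableSpace (suslinSigma U) (ae (Measure.hausdorffMeasure ((m : ℝ) - 1)))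

/-- `ν`, a finite signed Radon measure on `U`, is the distributional divergence in `U` of the
vector field `u`: `∫_U u · ∇φ dx = - ∫_U φ dν` for all `φ ∈ C_c^∞(U)`. -/
def IsDivergence {m : ℕ} (U : Set (Euc m)) (u : U → Euc m) (ν : SignedMeasure U) : Prop :=
  ∀ φ : Euc m → ℝ, ContDiff ℝ ∞ φ → HasCompactSupport φ → tsupport φ ⊆ U →
    ∫ x : U, inner ℝ (u x) (gradient φ x) ∂(leb U) = - ∫ᵛ x : U, φ x ∂•ν

/-- `u` is a bounded divergence measure field on `U` with divergence `ν`; here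
`u ∈ 𝒟ℳ_∞(U)` means that this holds for some (necessarily unique) `ν`. -/
structure IsDivMeasureField {m : ℕ} (U : Set (Euc m)) (u : U → Euc m)
    (ν : SignedMeasure U) : Prop where
  memLp : MemLp u ⊤ (leb U)
  divergence : IsDivergence U u ν

/-- The bounded fluctuation seminorm
`‖f‖_BF(U) = sup {∫_U f d(div u) : u ∈ 𝒟ℳ_∞(U), ‖u‖_{L_∞(U; ℝᵐ)} ≤ 1}`, as an element of
`[0, ∞]`; the supremum is nonnegative because `u = 0` is admissible. -/
def bfSeminorm {m : ℕ} (U : Set (Euc m)) (f : U → ℝ) : ℝ≥0∞ :=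
  ⨆ (u : U → Euc m) (ν : SignedMeasure U) (_ : IsDivMeasureField U u ν)
    (_ : eLpNorm u ⊤ (leb U) ≤ 1), ENNReal.ofReal (∫ᵛ x : U, f x ∂•ν)

/-- `f ∈ ℬℱ_∞(U)`: a bounded function `f : U → ℝ`, measurable for the completed Suslin
σ-algebra, whose bounded fluctuation seminorm is finite. -/
structure HasBoundedFluctuation {m : ℕ} (U : Set (Euc m)) (f : U → ℝ) : Prop where
  bounded : ∃ C : ℝ, ∀ x, |f x| ≤ C
  measurable : Measurable[suslinCompletion U] f
  finite : bfSeminorm U f < ⊤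

/-- The Sobolev exponent `1* = m / (m - 1) ∈ (1, ∞]`, equal to `∞` for `m = 1`. -/
def sobolevExponent (m : ℕ) : ℝ≥0∞ := (m : ℝ≥0∞) / ((m : ℝ≥0∞) - 1)

/-- `C` is admissible in the Gagliardo–Nirenberg–Sobolev inequality on `ℝᵐ`:
`‖φ‖_{L_{1*}(ℝᵐ)} ≤ C ‖∇φ‖_{L_1(ℝᵐ)}` for all `φ ∈ C_c^∞(ℝᵐ)`. -/
def IsSobolevConstant (m : ℕ) (C : ℝ≥0) : Prop :=
  ∀ φ : Euc m → ℝ, ContDiff ℝ ∞ φ → HasCompactSupport φ →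
    eLpNorm φ (sobolevExponent m) volume ≤ C * eLpNorm (gradient φ) 1 volume

/-- The optimal constant `ω_m` in the Gagliardo–Nirenberg–Sobolev inequality on `ℝᵐ`. -/
def optimalSobolevConstant (m : ℕ) : ℝ≥0 := sInf {C : ℝ≥0 | IsSobolevConstant m C}

end BoundedFluct

end

/-!
The inequality is dual to the Gagliardo–Nirenberg–Sobolev inequality. Let `g ∈ L₁(U) ∩ L_m(U)`; the
exponent `m` is conjugate to `1* = m / (m - 1)`. By Hölder and Sobolev,
`|∫_U φ g| ≤ ω_m ‖g‖_m ‖∇φ‖₁` for every test function `φ` on `ℝᵐ`, whether or not its support lies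
in `U`. Thus `∇φ ↦ -∫_U φ g` is a bounded functional on a subspace of `L₁(ℝᵐ; ℝᵐ)`. Extending it by
Hahn–Banach and representing the extension by a bounded field `u` gives `div u = g` in `U` with
`‖u‖_∞ ≤ ω_m ‖g‖_m` (`IsSobolevConstant.exists_isDivMeasureField`). Consequently
`∫_U f g = ∫_U f d(div u) ≤ ω_m ‖g‖_m ‖f‖_BF` (`IsSobolevConstant.ofReal_integral_mul_le`), and the
converse of Hölder's inequality (`eLpNorm_le_of_forall_integral_mul_le`) bounds `‖f‖_{1*}`.

Four facts support this argument.

* A function measurable for the completed Suslin σ-algebra is Lebesgue measurable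
  (`aestronglyMeasurable_of_measurable_suslinCompletion`): analytic sets are measurable for the
  completion of every σ-finite Borel measure, and `(m - 1)`-dimensional Hausdorff null sets are
  Lebesgue null.
* The dual of `L₁` of a σ-finite measure, with values in a Hilbert space `E`, is `L_∞`
  (`exists_integral_inner_eq`). A weight reduces this to finite measures, where `L₂ ⊆ L₁` and the
  Riesz representation in `L₂` applies; it yields the bound for the norm of `E` itself, hence for
  the Euclidean length of the field, without loss of a constant.
* The Sobolev inequality holds with some constant (for `m = 1` by the fundamental theorem of
  calculus), and the infimum of the admissible constants is itself admissible
  (`isSobolevConstant_optimalSobolevConstant`).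
* Integrating a bounded function against the signed measure with density `g` amounts to integrating
  its product with `g` (`integral_withDensityᵥ`).
-/

namespace BoundedFluct

open Filter Topology

/-! ### Analytic sets are Lebesgue measurable -/

section Analytic

variable {X : Type*} [MetricSpace X]

/-- If `x` lies in the closure of the image of each set of sequences whose first `k` terms are
bounded by those of `N`, then it is the image of a sequence. The approximating sequences are
truncated by `N`, which puts them into a compact set without changing any given coordinate of
all but finitely many of them. -/
lemma iInter_closure_image_subset_range {g : (ℕ → ℕ) → X} (hg : Continuous g) (N : ℕ → ℕ) :
    ⋂ k, closure (g '' {x | ∀ i < k, x i ≤ N i}) ⊆ range g := by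
  intro y hy
  rw [mem_iInter] at hy
  have h1 : ∀ k : ℕ, ∃ x : ℕ → ℕ, (∀ i < k, x i ≤ N i) ∧ dist y (g x) < 1 / ((k : ℝ) + 1) := by
    intro k
    obtain ⟨_, ⟨x, hx, rfl⟩, h⟩ :=
      Metric.mem_closure_iff.1 (hy k) (1 / ((k : ℝ) + 1)) (by positivity)
    exact ⟨x, hx, h⟩
  choose x hx hd using h1
  have hcomp : IsCompact (Set.pi univ fun i : ℕ => Iic (N i)) :=
    isCompact_univ_pi fun i => (finite_Iic (N i)).isCompact
  obtain ⟨z, -, s, hs, hz⟩ := hcomp.tendsto_subseq (x := fun k i => min (x k i) (N i))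
    (fun k i _ => mem_Iic.2 (min_le_right _ _))
  have hz' : Tendsto (fun k => x (s k)) atTop (𝓝 z) := by
    rw [tendsto_pi_nhds] at hz ⊢
    intro i
    refine (hz i).congr' ?_
    filter_upwards [eventually_gt_atTop i] with k hk
    exact min_eq_left (hx (s k) i (hk.trans_le hs.le_apply))
  refine ⟨z, tendsto_nhds_unique ((hg.tendsto z).comp hz') ?_⟩
  have h2 : Tendsto (fun k => g (x k)) atTop (𝓝 y) := by
    rw [tendsto_iff_dist_tendsto_zero]
    refine squeeze_zero (fun _ => dist_nonneg) (fun k => ?_)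
      (tendsto_one_div_add_atTop_nhds_zero_nat (𝕜 := ℝ))
    rw [dist_comm]
    exact (hd k).le
  exact h2.comp hs.tendsto_atTop

variable [MeasurableSpace X] [BorelSpace X]

/-- Inner regularity of the outer measure of an analytic set with respect to closed sets. -/
lemma exists_isClosed_subset_range_le_measure {g : (ℕ → ℕ) → X} (hg : Continuous g)
    (μ : Measure X) [IsFiniteMeasure μ] {c : ℝ≥0∞} (hc : c < μ (range g)) :
    ∃ D ⊆ range g, IsClosed D ∧ c ≤ μ D := by
  let A : ℕ → (ℕ → ℕ) → Set X := fun k N => g '' {x | ∀ i < k, x i ≤ N i}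
  -- one more coordinate can be bounded while keeping the outer measure above `c`, because
  -- outer measures are continuous along increasing unions of arbitrary sets
  have step : ∀ k N, c < μ (A k N) → ∃ n, c < μ (A (k + 1) (Function.update N k n)) := by
    intro k N h
    have hmono : Monotone fun n => A (k + 1) (Function.update N k n) := by
      rintro a b hab _ ⟨x, hx, rfl⟩
      refine ⟨x, fun i hi => (hx i hi).trans ?_, rfl⟩
      rcases eq_or_ne i k with rfl | hik
      · simpa using hab
      · simp [hik]
    have hU : A k N ⊆ ⋃ n, A (k + 1) (Function.update N k n) := by
      rintro _ ⟨x, hx, rfl⟩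
      refine mem_iUnion.2 ⟨x k, x, fun i hi => ?_, rfl⟩
      rcases eq_or_ne i k with rfl | hik
      · simp
      · simpa [hik] using hx i (by omega)
    have h' := h.trans_le (measure_mono hU)
    rw [hmono.measure_iUnion] at h'
    exact lt_iSup_iff.1 h'
  choose! n hn using step
  let M : ℕ → ℕ → ℕ := fun k => Nat.rec 0 (fun k N => Function.update N k (n k N)) k
  have hMs : ∀ k, M (k + 1) = Function.update (M k) k (n k (M k)) := fun k => rfl
  have hM : ∀ k, c < μ (A k (M k)) := by
    intro k
    induction k with
    | zero => simpa [A] using hc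
    | succ k ih => rw [hMs]; exact hn k _ ih
  let N : ℕ → ℕ := fun i => M (i + 1) i
  have hMN : ∀ k, ∀ i < k, M k i = N i := by
    intro k
    induction k with
    | zero => intro i hi; omega
    | succ k ih =>
      intro i hi
      rcases eq_or_ne i k with rfl | hik
      · rfl
      · rw [hMs, Function.update_of_ne hik, ih i (by omega)]
  have hN : ∀ k, c < μ (A k N) := by
    intro k
    have : A k N = A k (M k) := by
      have : {x : ℕ → ℕ | ∀ i < k, x i ≤ N i} = {x | ∀ i < k, x i ≤ M k i} := by
        ext x
        exact forall₂_congr fun i hi => by rw [hMN k i hi]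
      simp only [A, this]
    rw [this]
    exact hM k
  refine ⟨_, iInter_closure_image_subset_range hg N, isClosed_iInter fun k => isClosed_closure, ?_⟩
  have hanti : Antitone fun k => closure (A k N) := by
    intro a b hab
    exact closure_mono (image_mono fun x hx i hi => hx i (hi.trans_le hab))
  refine ge_of_tendsto' (tendsto_measure_iInter_atTop
    (fun k => isClosed_closure.measurableSet.nullMeasurableSet) hanti ⟨0, measure_ne_top _ _⟩)
    fun k => (hN k).le.trans (measure_mono subset_closure)

/-- Analytic sets are measurable for the completion of every σ-finite Borel measure. -/
lemma nullMeasurableSet_of_analyticSet {s : Set X} (hs : AnalyticSet s) (μ : Measure X)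
    [SigmaFinite μ] : NullMeasurableSet s μ := by
  obtain ⟨μ', hfin, hac, -⟩ := exists_isFiniteMeasure_absolutelyContinuous μ
  refine NullMeasurableSet.mono_ac ?_ hac
  rw [AnalyticSet] at hs
  rcases hs with rfl | ⟨g, hg, rfl⟩
  · exact nullMeasurableSet_empty
  rcases eq_or_ne (μ' (range g)) 0 with h0 | h0
  · exact NullMeasurableSet.of_null h0
  obtain ⟨c, -, hlt, hc⟩ := exists_seq_strictMono_tendsto' (pos_iff_ne_zero.2 h0)
  choose D hD hcl hcD using fun k => exists_isClosed_subset_range_le_measure hg μ' (hlt k).2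
  have hsub : ⋃ k, D k ⊆ range g := iUnion_subset hD
  have hmeas : MeasurableSet (⋃ k, D k) := .iUnion fun k => (hcl k).measurableSet
  have hle : μ' (range g) ≤ μ' (⋃ k, D k) :=
    le_of_tendsto' hc fun k => (hcD k).trans (measure_mono (subset_iUnion D k))
  have := ae_eq_of_subset_of_measure_ge hsub hle hmeas.nullMeasurableSet (measure_ne_top _ _)
  exact hmeas.nullMeasurableSet.congr this

end Analytic

/-- Lebesgue measure on `U ⊆ ℝᵐ` is absolutely continuous with respect to the
`(m - 1)`-dimensional Hausdorff measure. -/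
lemma leb_absolutelyContinuous_hausdorffMeasure {m : ℕ} {U : Set (Euc m)} (hU : MeasurableSet U) :
    leb U ≪ Measure.hausdorffMeasure ((m : ℝ) - 1) := by
  intro s hs
  have h1 : Measure.hausdorffMeasure (m : ℝ) s = 0 :=
    le_antisymm ((Measure.hausdorffMeasure_mono (by linarith) s).trans hs.le) zero_le
  rw [← isometry_subtype_coe.hausdorffMeasure_image (.inl (by positivity))] at h1
  rw [leb, (MeasurableEmbedding.subtype_coe hU).comap_apply]
  have := isAddHaarMeasure_hausdorffMeasure (E := Euc m)
  rw [finrank_euclideanSpace_fin] at this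
  rw [Measure.isAddLeftInvariant_eq_smul (volume : Measure (Euc m))
    (Measure.hausdorffMeasure (m : ℝ))]
  simp [h1]

lemma map_coe_leb {m : ℕ} {U : Set (Euc m)} (hU : MeasurableSet U) :
    (leb U).map Subtype.val = volume.restrict U := by
  rw [leb, (MeasurableEmbedding.subtype_coe hU).map_comap, Subtype.range_coe]

lemma sigmaFinite_leb {m : ℕ} {U : Set (Euc m)} (hU : MeasurableSet U) : SigmaFinite (leb U) := by
  have : SigmaFinite ((leb U).map Subtype.val) := by rw [map_coe_leb hU]; infer_instance
  exact SigmaFinite.of_map _ measurable_subtype_coe.aemeasurable this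

/-- Functions that are measurable for the completed Suslin σ-algebra are Lebesgue measurable. -/
lemma aestronglyMeasurable_of_measurable_suslinCompletion {m : ℕ} {U : Set (Euc m)}
    (hU : MeasurableSet U) {f : U → ℝ} (hf : Measurable[suslinCompletion U] f) :
    AEStronglyMeasurable f (leb U) := by
  have := sigmaFinite_leb hU
  have hf' : NullMeasurable f (leb U) := by
    intro s hs
    obtain ⟨t, ht, hst⟩ := hf hs
    have h1 : suslinSigma U ≤
        (inferInstance : MeasurableSpace (NullMeasurableSpace U (leb U))) :=
      MeasurableSpace.generateFrom_le fun t ht => nullMeasurableSet_of_analyticSet ht (leb U)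
    have h2 : NullMeasurableSet t (leb U) := h1 t ht
    have h3 : f ⁻¹' s =ᵐ[leb U] t := (leb_absolutelyContinuous_hausdorffMeasure hU).ae_le hst
    exact h2.congr h3.symm
  exact hf'.aemeasurable.aestronglyMeasurable

/-! ### The dual of `L¹` -/

section DualL1

variable {X E : Type*} [MeasurableSpace X] [NormedAddCommGroup E] [InnerProductSpace ℝ E]
  [CompleteSpace E]

/-- Riesz representation of the dual of `L¹` of a finite measure: the functional is represented
on `L²` by Hilbert space duality, and its norm bounds the representing function. -/
lemma exists_integral_inner_eq_of_isFiniteMeasure (ν : Measure X) [IsFiniteMeasure ν]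
    (Λ : Lp E 1 ν →L[ℝ] ℝ) :
    ∃ u : X → E, StronglyMeasurable u ∧ (∀ᵐ x ∂ν, ‖u x‖ ≤ ‖Λ‖) ∧
      ∀ v : Lp E 1 ν, Λ v = ∫ x, inner ℝ (u x) (v x) ∂ν := by
  have hmem (v : Lp E 2 ν) : MemLp v 1 ν := (Lp.memLp v).mono_exponent one_le_two
  let J : Lp E 2 ν →ₗ[ℝ] Lp E 1 ν :=
    { toFun := fun v => (hmem v).toLp
      map_add' := fun v w => by
        rw [← MemLp.toLp_add]
        exact MemLp.toLp_congr _ _ (Lp.coeFn_add v w)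
      map_smul' := fun c v => by
        rw [RingHom.id_apply, ← MemLp.toLp_const_smul]
        exact MemLp.toLp_congr _ _ (Lp.coeFn_smul c v) }
  have hJ (v : Lp E 2 ν) : ‖J v‖ ≤ (ν univ ^ (1 / 2 : ℝ)).toReal * ‖v‖ := by
    have h1 : eLpNorm v 1 ν ≤ eLpNorm v 2 ν * ν univ ^ (1 / 2 : ℝ) := by
      refine (eLpNorm_le_eLpNorm_mul_rpow_measure_univ one_le_two (Lp.aestronglyMeasurable v)).trans
        (le_of_eq ?_)
      norm_num
    change ‖(hmem v).toLp‖ ≤ _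
    rw [Lp.norm_toLp, Lp.norm_def, mul_comm, ← ENNReal.toReal_mul]
    exact ENNReal.toReal_mono (ENNReal.mul_ne_top (Lp.eLpNorm_ne_top v)
      (ENNReal.rpow_ne_top_of_nonneg (by norm_num) (measure_ne_top _ _))) h1
  let Jc : Lp E 2 ν →L[ℝ] Lp E 1 ν := J.mkContinuous _ hJ
  let U : Lp E 2 ν := (InnerProductSpace.toDual ℝ (Lp E 2 ν)).symm (Λ.comp Jc)
  have hU (v : X → E) (hv : MemLp v 2 ν) (hv1 : MemLp v 1 ν) :
      Λ hv1.toLp = ∫ x, inner ℝ (U x) (v x) ∂ν := by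
    have h1 : inner ℝ U hv.toLp = Λ (Jc hv.toLp) := by
      simp [U]
    have h2 : Jc hv.toLp = hv1.toLp := MemLp.toLp_congr (hmem _) hv1 hv.coeFn_toLp
    rw [← h2, ← h1, L2.inner_def]
    refine integral_congr_ae ?_
    filter_upwards [hv.coeFn_toLp] with x hx
    rw [hx]
  have hUsm : StronglyMeasurable U := Lp.stronglyMeasurable U
  have hUint : Integrable U ν := memLp_one_iff_integrable.1 (hmem U)
  -- testing with the direction of `U` on a set `s` bounds the mean of `‖U‖` over `s`
  have hbd : ∀ᵐ x ∂ν, ‖U x‖ ≤ ‖Λ‖ := by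
    refine ae_le_of_forall_setIntegral_le hUint.norm (integrable_const _) fun s hs _ => ?_
    let v : X → E := s.indicator fun x => ‖U x‖⁻¹ • U x
    have hvm : StronglyMeasurable v := 
      (hUsm.norm.measurable.inv.stronglyMeasurable.smul hUsm).indicator hs
    have hvb (x : X) : ‖v x‖ ≤ s.indicator (fun _ => (1 : ℝ)) x := by
      by_cases hx : x ∈ s
      · simp only [v, indicator_of_mem hx, norm_smul, norm_inv, norm_norm]
        exact inv_mul_le_one
      · simp [v, hx]
    have hvb1 (x : X) : ‖v x‖ ≤ 1 := (hvb x).trans (indicator_le_self' (by simp) x)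
    have hv (p : ℝ≥0∞) : MemLp v p ν :=
      .of_bound hvm.aestronglyMeasurable 1 (.of_forall hvb1)
    have h1 : ∫ x, inner ℝ (U x) (v x) ∂ν = ∫ x in s, ‖U x‖ ∂ν := by
      rw [← integral_indicator hs]
      refine integral_congr_ae (.of_forall fun x => ?_)
      by_cases hx : x ∈ s
      · simp only [v, indicator_of_mem hx, inner_smul_right, real_inner_self_eq_norm_mul_norm]
        rcases eq_or_ne ‖U x‖ 0 with h | h
        · simp [h]
        · field_simp
      · simp [v, hx]
    have h2 : ‖(hv 1).toLp‖ ≤ ν.real s := by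
      rw [Lp.norm_toLp, Measure.real]
      refine ENNReal.toReal_mono (measure_ne_top _ _) ?_
      rw [eLpNorm_one_eq_lintegral_enorm, ← lintegral_indicator_one hs]
      refine lintegral_mono fun x => ?_
      by_cases hx : x ∈ s
      · simpa [hx, ← ofReal_norm] using hvb1 x
      · simp [v, hx]
    rw [← h1, ← hU v (hv 2) (hv 1), setIntegral_const, smul_eq_mul, mul_comm]
    exact (le_abs_self _).trans ((Λ.le_opNorm _).trans (by gcongr))
  refine ⟨U, hUsm, hbd, fun v => ?_⟩
  have hint (v : Lp E 1 ν) : Integrable (fun x => inner ℝ (U x) (v x)) ν := by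
    refine ((memLp_one_iff_integrable.1 (Lp.memLp v)).norm.const_mul ‖Λ‖).mono'
      (hUsm.aestronglyMeasurable.inner (Lp.aestronglyMeasurable v)) ?_
    filter_upwards [hbd] with x hx
    exact (norm_inner_le_norm _ _).trans (by gcongr)
  -- both sides are continuous in `v` and agree on simple functions
  induction v using Lp.induction (p := 1) ENNReal.one_ne_top with
  | indicatorConst c hs hμs =>
    rename_i s
    have h1 := hU _ (memLp_indicator_const 2 hs c (.inr hμs.ne))
      (memLp_indicator_const 1 hs c (.inr hμs.ne))
    simp only [Lp.simpleFunc.coe_indicatorConst]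
    rw [indicatorConstLp, h1]
    refine integral_congr_ae ?_
    filter_upwards [MemLp.coeFn_toLp (memLp_indicator_const 1 hs c (.inr hμs.ne))] with x hx
    rw [hx]
  | add hf hg hfg h1 h2 =>
    rename_i f g
    rw [map_add, h1, h2, ← integral_add (hint _) (hint _)]
    refine integral_congr_ae ?_
    filter_upwards [Lp.coeFn_add hf.toLp hg.toLp] with x hx
    rw [hx, Pi.add_apply, inner_add_right]
  | isClosed =>
    refine isClosed_eq Λ.continuous ?_
    refine (LipschitzWith.of_dist_le_mul (K := ‖Λ‖₊) fun v w => ?_).continuous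
    rw [Real.dist_eq, ← integral_sub (hint _) (hint _), dist_eq_norm, L1.norm_eq_integral_norm]
    rw [← integral_const_mul, ← Real.norm_eq_abs]
    refine norm_integral_le_of_norm_le ((L1.integrable_coeFn _).norm.const_mul _) ?_
    filter_upwards [hbd, Lp.coeFn_sub v w] with x hx hxs
    rw [hxs, Pi.sub_apply, ← inner_sub_right]
    exact (norm_inner_le_norm _ _).trans (by gcongr; exact hx)

/-- Riesz representation of the dual of `L¹` of a σ-finite measure, for functions with values in a
Hilbert space. -/
lemma exists_integral_inner_eq (μ : Measure X) [SigmaFinite μ] (Λ : Lp E 1 μ →L[ℝ] ℝ) :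
    ∃ u : X → E, StronglyMeasurable u ∧ (∀ᵐ x ∂μ, ‖u x‖ ≤ ‖Λ‖) ∧
      ∀ v : Lp E 1 μ, Λ v = ∫ x, inner ℝ (u x) (v x) ∂μ := by
  -- a strictly positive weight `w` makes the measure finite without changing its null sets, and
  -- multiplication by `w` is an isometry between the two `L¹` spaces
  obtain ⟨w, hw0, hwm, hw⟩ := exists_pos_lintegral_lt_of_sigmaFinite μ one_ne_zero
  have hfin : IsFiniteMeasure (μ.withDensity fun x => (w x : ℝ≥0∞)) :=
    isFiniteMeasure_withDensity (hw.trans ENNReal.one_lt_top).ne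
  have hac : μ ≪ μ.withDensity fun x => (w x : ℝ≥0∞) :=
    withDensity_absolutelyContinuous' hwm.coe_nnreal_ennreal.aemeasurable
      (.of_forall fun x => by simpa using (hw0 x).ne')
  let I := withDensitySMulLI (E := E) μ hwm
  obtain ⟨u, hum, hub, hu⟩ := exists_integral_inner_eq_of_isFiniteMeasure
    (μ.withDensity fun x => (w x : ℝ≥0∞)) (Λ.comp I.toContinuousLinearMap)
  refine ⟨u, hum, ?_, fun v => ?_⟩
  · filter_upwards [hac.ae_le hub] with x hx
    refine hx.trans ((Λ.opNorm_comp_le _).trans ?_)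
    exact mul_le_of_le_one_right (norm_nonneg _) I.norm_toContinuousLinearMap_le
  · have hcancel (x : X) : w x • (w x)⁻¹ • v x = v x := smul_inv_smul₀ (hw0 x).ne' _
    have hv : MemLp (fun x => (w x)⁻¹ • v x) 1 (μ.withDensity fun x => (w x : ℝ≥0∞)) := by
      rw [memLp_one_iff_integrable, integrable_withDensity_iff_integrable_smul hwm]
      simpa only [hcancel] using L1.integrable_coeFn v
    have h1 : I hv.toLp = v := by
      refine Lp.ext ?_
      filter_upwards [(memL1_smul_of_L1_withDensity hwm hv.toLp).coeFn_toLp,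
        hac.ae_le hv.coeFn_toLp] with x hx hx'
      rw [withDensitySMulLI_apply, hx, hx', hcancel]
    have h2 := hu hv.toLp
    simp only [ContinuousLinearMap.comp_apply, LinearIsometry.coe_toContinuousLinearMap, h1] at h2
    rw [h2, integral_withDensity_eq_integral_smul hwm]
    refine integral_congr_ae ?_
    filter_upwards [hac.ae_le hv.coeFn_toLp] with x hx
    rw [hx, ← inner_smul_right_eq_smul, hcancel]

end DualL1

/-! ### The Gagliardo–Nirenberg–Sobolev constant -/

lemma norm_gradient {m : ℕ} (φ : Euc m → ℝ) (x : Euc m) : ‖gradient φ x‖ = ‖fderiv ℝ φ x‖ := by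
  rw [gradient, LinearIsometryEquiv.norm_map]

lemma continuous_gradient {m : ℕ} {φ : Euc m → ℝ} (hφ : ContDiff ℝ ∞ φ) :
    Continuous (gradient φ) :=
  (InnerProductSpace.toDual ℝ (Euc m)).symm.continuous.comp (hφ.continuous_fderiv (by simp))

lemma gradient_eq_zero_of_notMem_tsupport {m : ℕ} {φ : Euc m → ℝ} {x : Euc m}
    (hx : x ∉ tsupport φ) : gradient φ x = 0 := by
  have h : fderiv ℝ φ x = 0 := by
    by_contra h
    exact hx (support_fderiv_subset ℝ (Function.mem_support.2 h))
  rw [gradient, h, map_zero]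

lemma hasCompactSupport_gradient {m : ℕ} {φ : Euc m → ℝ} (hφ : HasCompactSupport φ) :
    HasCompactSupport (gradient φ) :=
  HasCompactSupport.intro hφ fun _ => gradient_eq_zero_of_notMem_tsupport

lemma memLp_gradient {m : ℕ} {φ : Euc m → ℝ} (hφ : ContDiff ℝ ∞ φ)
    (hc : HasCompactSupport φ) : MemLp (gradient φ) 1 :=
  memLp_one_iff_integrable.2 ((continuous_gradient hφ).integrable_of_hasCompactSupport
    (hasCompactSupport_gradient hc))

lemma holderConjugate_sobolevExponent {m : ℕ} (hm : 1 ≤ m) :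
    ENNReal.HolderConjugate (sobolevExponent m) m := by
  rw [ENNReal.holderConjugate_iff, sobolevExponent]
  have hm0 : (m : ℝ≥0∞) ≠ 0 := by simp; omega
  have hmt : (m : ℝ≥0∞) ≠ ⊤ := ENNReal.natCast_ne_top m
  rw [ENNReal.inv_div (.inr hmt) (.inr hm0), ← one_div,
    ENNReal.div_add_div_same, tsub_add_cancel_of_le (by exact_mod_cast hm),
    ENNReal.div_self hm0 hmt]

/-- The fundamental theorem of calculus gives the one-dimensional Sobolev inequality. -/
lemma isSobolevConstant_one : IsSobolevConstant 1 1 := by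
  intro φ hφ hc
  have hp : sobolevExponent 1 = ⊤ := by simp [sobolevExponent]
  let e : ℝ ≃ₗᵢ[ℝ] Euc 1 := (OrthonormalBasis.singleton (Fin 1) ℝ).repr
  have hψ : ContDiff ℝ 1 (φ ∘ e) := (hφ.comp e.contDiff).of_le (by simp)
  have hψc : HasCompactSupport (φ ∘ e) := hc.comp_homeomorph e.toHomeomorph
  rw [hp, eLpNorm_exponent_top, eLpNorm_one_eq_lintegral_enorm, ENNReal.coe_one, one_mul]
  refine eLpNormEssSup_le_of_ae_enorm_bound (.of_forall fun x => ?_)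
  calc ‖φ x‖ₑ = ‖(φ ∘ e) (e.symm x)‖ₑ := by simp
    _ ≤ ∫⁻ t in Iic (e.symm x), ‖deriv (φ ∘ e) t‖ₑ := hψc.enorm_le_lintegral_Ici_deriv hψ _
    _ ≤ ∫⁻ t, ‖deriv (φ ∘ e) t‖ₑ := setLIntegral_le_lintegral _ _
    _ ≤ ∫⁻ t, ‖gradient φ (e t)‖ₑ := by
        refine lintegral_mono fun t => ?_
        have h1 : HasDerivAt (φ ∘ e) (fderiv ℝ φ (e t) (e 1)) t := by
          have := (hφ.differentiable (by simp) (e t)).hasFDerivAt.comp t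
            (e : ℝ →L[ℝ] Euc 1).hasFDerivAt
          simpa using this.hasDerivAt
        rw [h1.deriv, enorm_le_iff_norm_le, norm_gradient]
        refine (ContinuousLinearMap.le_opNorm _ _).trans ?_
        simp
    _ = ∫⁻ x, ‖gradient φ x‖ₑ :=
        e.measurePreserving.lintegral_comp_emb e.toHomeomorph.measurableEmbedding
          fun x => ‖gradient φ x‖ₑ

/-- The Gagliardo–Nirenberg–Sobolev inequality holds with some finite constant. -/
lemma exists_isSobolevConstant {m : ℕ} (hm : 1 ≤ m) : ∃ C, IsSobolevConstant m C := by
  rcases hm.eq_or_lt with rfl | hm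
  · exact ⟨1, isSobolevConstant_one⟩
  have hc : NNReal.HolderConjugate m (NNReal.conjExponent m) :=
    .conjExponent (by exact_mod_cast hm)
  have hp : sobolevExponent m = (NNReal.conjExponent m : ℝ≥0) := by
    rw [sobolevExponent, NNReal.conjExponent, ENNReal.coe_div (by
      rw [Ne, tsub_eq_zero_iff_le, not_le]
      exact_mod_cast hm)]
    simp
  refine ⟨eLpNormLESNormFDerivOneConst (volume : Measure (Euc m)) (NNReal.conjExponent m),
    fun φ hφ hφc => ?_⟩
  rw [hp, eLpNorm_congr_norm_ae (f := gradient φ) (.of_forall (norm_gradient φ))]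
  exact eLpNorm_le_eLpNorm_fderiv_one volume (hφ.of_le (by simp)) hφc
    (by rwa [finrank_euclideanSpace_fin])

/-- The infimum defining the optimal constant is attained. -/
lemma isSobolevConstant_optimalSobolevConstant {m : ℕ} (hm : 1 ≤ m) :
    IsSobolevConstant m (optimalSobolevConstant m) := by
  intro φ hφ hc
  have hne : {C : ℝ≥0 | IsSobolevConstant m C}.Nonempty := exists_isSobolevConstant hm
  obtain ⟨s, -, hs, hsC⟩ := exists_seq_tendsto_sInf hne (OrderBot.bddBelow _)
  have hfin : eLpNorm (gradient φ) 1 volume ≠ ⊤ :=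
    (memLp_gradient hφ hc).eLpNorm_ne_top
  have h1 : Tendsto (fun n => (s n : ℝ≥0∞) * eLpNorm (gradient φ) 1 volume) atTop
      (𝓝 ((optimalSobolevConstant m : ℝ≥0∞) * eLpNorm (gradient φ) 1 volume)) :=
    ENNReal.Tendsto.mul_const (ENNReal.tendsto_coe.2 hs) (.inr hfin)
  exact ge_of_tendsto' h1 fun n => hsC n φ hφ hc

/-! ### Bounded vector fields with prescribed divergence -/

/-- The test functions `C_c^∞(ℝᵐ)`, as a space of functions. -/
def testFunctions (m : ℕ) : Submodule ℝ (Euc m → ℝ) where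
  carrier := {φ | ContDiff ℝ ∞ φ ∧ HasCompactSupport φ}
  zero_mem' := ⟨contDiff_const, HasCompactSupport.zero⟩
  add_mem' h₁ h₂ := ⟨h₁.1.add h₂.1, h₁.2.add h₂.2⟩
  smul_mem' c _ h := ⟨contDiff_const.smul h.1, h.2.smul_left (f := fun _ => c)⟩

/-- The gradient of a test function, as an element of `L₁(ℝᵐ; ℝᵐ)`. -/
noncomputable def gradientL1 (m : ℕ) :
    testFunctions m →ₗ[ℝ] Lp (Euc m) 1 (volume : Measure (Euc m)) where
  toFun φ := (memLp_gradient φ.2.1 φ.2.2).toLp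
  map_add' φ ψ := by
    rw [← MemLp.toLp_add]
    refine MemLp.toLp_congr _ _ (.of_forall fun x => ?_)
    have h₁ := φ.2.1.differentiable (by simp) x
    have h₂ := ψ.2.1.differentiable (by simp) x
    simp only [gradient, Pi.add_apply, Submodule.coe_add]
    rw [fderiv_add h₁ h₂, map_add]
  map_smul' c φ := by
    rw [RingHom.id_apply, ← MemLp.toLp_const_smul]
    refine MemLp.toLp_congr _ _ (.of_forall fun x => ?_)
    have h₁ := φ.2.1.differentiable (by simp) x
    simp only [gradient, Pi.smul_apply, Submodule.coe_smul]
    rw [fderiv_const_smul h₁, map_smul]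

lemma coeFn_gradientL1 {m : ℕ} (φ : testFunctions m) :
    gradientL1 m φ =ᵐ[volume] gradient (φ : Euc m → ℝ) :=
  (memLp_gradient φ.2.1 φ.2.2).coeFn_toLp

lemma enorm_gradientL1 {m : ℕ} (φ : testFunctions m) :
    ‖gradientL1 m φ‖ₑ = eLpNorm (gradient (φ : Euc m → ℝ)) 1 volume :=
  Lp.enorm_toLp (memLp_gradient φ.2.1 φ.2.2)

/-- Hahn–Banach: a linear functional bounded by a multiple of `‖T v‖` factors through `T`, with
control of the norm. -/
lemma exists_continuousLinearMap_comp_eq {V W : Type*} [AddCommGroup V] [Module ℝ V]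
    [NormedAddCommGroup W] [NormedSpace ℝ W] (T : V →ₗ[ℝ] W) (ℓ : V →ₗ[ℝ] ℝ) {c : ℝ} (hc : 0 ≤ c)
    (hℓ : ∀ v, |ℓ v| ≤ c * ‖T v‖) : ∃ Λ : W →L[ℝ] ℝ, ‖Λ‖ ≤ c ∧ ∀ v, Λ (T v) = ℓ v := by
  obtain ⟨s, hs⟩ := T.rangeRestrict.exists_rightInverse_of_surjective T.range_rangeRestrict
  have hTs (y : T.range) : T (s y) = y := congrArg Subtype.val (LinearMap.congr_fun hs y)
  let ℓ' : T.range →L[ℝ] ℝ := (ℓ ∘ₗ s).mkContinuous c fun y => by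
    have h := hℓ (s y)
    rw [hTs] at h
    exact h
  have hℓ' : ‖ℓ'‖ ≤ c := LinearMap.mkContinuous_norm_le _ hc _
  obtain ⟨Λ, hΛ, hΛn⟩ := exists_extension_norm_eq T.range ℓ'
  refine ⟨Λ, hΛn.trans_le hℓ', fun v => ?_⟩
  have h1 : Λ (T v) = ℓ (s ⟨T v, v, rfl⟩) := hΛ ⟨T v, v, rfl⟩
  have h2 : T (s ⟨T v, v, rfl⟩ - v) = 0 := by rw [map_sub, hTs, sub_self]
  have h3 := hℓ (s ⟨T v, v, rfl⟩ - v)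
  rw [h2, norm_zero, mul_zero, map_sub, abs_nonpos_iff, sub_eq_zero] at h3
  rw [h1, h3]

/-- A linear functional on test functions that is bounded by a multiple `c` of the `L₁` norm of the
gradient is given by integration against a vector field bounded by `c`. -/
lemma exists_field_of_abs_le {m : ℕ} (ℓ : testFunctions m →ₗ[ℝ] ℝ) {c : ℝ} (hc : 0 ≤ c)
    (hℓ : ∀ φ, |ℓ φ| ≤ c * ‖gradientL1 m φ‖) :
    ∃ u : Euc m → Euc m, StronglyMeasurable u ∧ (∀ᵐ x, ‖u x‖ ≤ c) ∧
      ∀ φ : testFunctions m, ∫ x, inner ℝ (u x) (gradient (φ : Euc m → ℝ) x) = ℓ φ := by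
  obtain ⟨Λ, hΛc, hΛ⟩ := exists_continuousLinearMap_comp_eq (gradientL1 m) ℓ hc hℓ
  obtain ⟨u, hum, hub, hu⟩ := exists_integral_inner_eq volume Λ
  refine ⟨u, hum, ?_, fun φ => ?_⟩
  · filter_upwards [hub] with x hx
    exact hx.trans hΛc
  · rw [← hΛ, hu]
    refine integral_congr_ae ?_
    filter_upwards [coeFn_gradientL1 φ] with x hx
    rw [hx]

lemma integral_coe_leb {m : ℕ} {U : Set (Euc m)} (hU : MeasurableSet U) {F : Type*}
    [NormedAddCommGroup F] [NormedSpace ℝ F] (h : Euc m → F) :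
    ∫ x : U, h x ∂leb U = ∫ x in U, h x :=
  integral_subtype_comap hU h

/-- Integration against a signed measure with a density. -/
lemma integral_withDensityᵥ {X : Type*} [MeasurableSpace X] {μ : Measure X} {g f : X → ℝ}
    (hg : Integrable g μ) (hf : AEStronglyMeasurable f μ) {C : ℝ} (hC : ∀ x, |f x| ≤ C) :
    ∫ᵛ x, f x ∂•(μ.withDensityᵥ g) = ∫ x, f x * g x ∂μ := by
  have h0 {h : X → ℝ} (hh : Integrable h μ) :
      IsFiniteMeasure (μ.withDensity fun x => ENNReal.ofReal (h x)) :=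
    isFiniteMeasure_withDensity_ofReal hh.2
  have := h0 hg
  have := h0 hg.neg
  have hac (h : X → ℝ≥0∞) : AEStronglyMeasurable f (μ.withDensity h) :=
    hf.mono_ac (withDensity_absolutelyContinuous μ _)
  have hI (h : X → ℝ≥0∞) [IsFiniteMeasure (μ.withDensity h)] :
      (μ.withDensity h).toSignedMeasure.Integrable f := by
    rw [VectorMeasure.Integrable, Measure.variation_toSignedMeasure]
    exact Integrable.of_bound (hac h) C (.of_forall hC)
  have hflip : ContinuousLinearMap.lsmul ℝ ℝ = (ContinuousLinearMap.lsmul ℝ ℝ (E := ℝ)).flip := by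
    ext
    simp
  have hint {h : X → ℝ} (hh : Integrable h μ) :
      ∫ x, f x ∂(μ.withDensity fun x => ENNReal.ofReal (h x)) = ∫ x, f x * max (h x) 0 ∂μ := by
    rw [integral_withDensity_eq_integral_toReal_smul₀ hh.1.aemeasurable.ennreal_ofReal (by simp)]
    refine integral_congr_ae (.of_forall fun x => ?_)
    simp [ENNReal.toReal_ofReal', mul_comm]
  rw [withDensityᵥ_eq_withDensity_pos_part_sub_withDensity_neg_part hg,
    VectorMeasure.integral_sub_vectorMeasure (hI _) (hI _), hflip,
    VectorMeasure.integral_toSignedMeasure, VectorMeasure.integral_toSignedMeasure, hint hg,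
    show ∫ x, f x ∂(μ.withDensity fun x => ENNReal.ofReal (-g x)) = _ from hint hg.neg,
    ← integral_sub]
  · refine integral_congr_ae (.of_forall fun x => ?_)
    dsimp only
    rw [← mul_sub, max_zero_sub_max_neg_zero_eq_self]
  · exact hg.pos_part.bdd_mul hf (.of_forall hC)
  · exact hg.neg.pos_part.bdd_mul hf (.of_forall hC)

lemma eLpNorm_one_mul_le {X : Type*} [MeasurableSpace X] {μ : Measure X} {f g : X → ℝ}
    {p q : ℝ≥0∞} [p.HolderConjugate q] (hf : AEStronglyMeasurable f μ)
    (hg : AEStronglyMeasurable g μ) :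
    eLpNorm (fun x => f x * g x) 1 μ ≤ eLpNorm f p μ * eLpNorm g q μ := by
  simpa using eLpNorm_le_eLpNorm_mul_eLpNorm_of_nnnorm (r := 1) hf hg (· * ·) 1
    (.of_forall fun x => by simp [nnnorm_mul])

variable {m : ℕ} {U : Set (Euc m)}

/-- `|∫_U φ g| ≤ C ‖g‖_m ‖∇φ‖₁` for every admissible Sobolev constant `C`: Hölder's inequality
followed by Sobolev's. -/
lemma IsSobolevConstant.enorm_integral_mul_le {C : ℝ≥0} (hC : IsSobolevConstant m C) (hm : 1 ≤ m)
    (hU : MeasurableSet U) {g : U → ℝ} (hg : AEStronglyMeasurable g (leb U))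
    (φ : testFunctions m) :
    ‖∫ x : U, (φ : Euc m → ℝ) x * g x ∂leb U‖ₑ ≤
      C * eLpNorm g m (leb U) * ‖gradientL1 m φ‖ₑ := by
  have := holderConjugate_sobolevExponent hm
  have hφ : AEStronglyMeasurable (fun x : U => (φ : Euc m → ℝ) x) (leb U) :=
    (φ.2.1.continuous.comp continuous_subtype_val).aestronglyMeasurable
  have h1 : eLpNorm (fun x : U => (φ : Euc m → ℝ) x) (sobolevExponent m) (leb U) ≤
      eLpNorm (φ : Euc m → ℝ) (sobolevExponent m) volume := by
    have h := (MeasurableEmbedding.subtype_coe hU).eLpNorm_map_measure (μ := leb U)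
      (g := (φ : Euc m → ℝ)) (p := sobolevExponent m)
    rw [map_coe_leb hU] at h
    exact h.symm.trans_le (eLpNorm_restrict_le _ _ _ _)
  calc ‖∫ x : U, (φ : Euc m → ℝ) x * g x ∂leb U‖ₑ
      ≤ eLpNorm (fun x : U => (φ : Euc m → ℝ) x * g x) 1 (leb U) := by
        rw [eLpNorm_one_eq_lintegral_enorm]
        exact enorm_integral_le_lintegral_enorm _
    _ ≤ eLpNorm (fun x : U => (φ : Euc m → ℝ) x) (sobolevExponent m) (leb U) *
          eLpNorm g m (leb U) :=
        eLpNorm_one_mul_le hφ hg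
    _ ≤ (C * eLpNorm (gradient (φ : Euc m → ℝ)) 1 volume) * eLpNorm g m (leb U) := by
        gcongr
        exact h1.trans (hC _ φ.2.1 φ.2.2)
    _ = _ := by rw [enorm_gradientL1]; ring

/-- Every integrable `g ∈ L_m(U)` is the divergence of a bounded vector field whose norm is at most
`C ‖g‖_m`, where `C` is an admissible Sobolev constant. -/
lemma IsSobolevConstant.exists_isDivMeasureField {C : ℝ≥0} (hC : IsSobolevConstant m C)
    (hm : 1 ≤ m) (hU : MeasurableSet U) {g : U → ℝ} (hg : Integrable g (leb U))
    (hgm : MemLp g m (leb U)) :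
    ∃ u : U → Euc m, IsDivMeasureField U u ((leb U).withDensityᵥ g) ∧
      eLpNorm u ⊤ (leb U) ≤ C * eLpNorm g m (leb U) := by
  have hint (φ : testFunctions m) : Integrable (fun x : U => (φ : Euc m → ℝ) x * g x) (leb U) := by
    obtain ⟨B, hB⟩ := φ.2.2.exists_bound_of_continuous φ.2.1.continuous
    exact hg.bdd_mul
      (φ.2.1.continuous.comp continuous_subtype_val).aestronglyMeasurable (.of_forall fun x => hB x)
  let ℓ : testFunctions m →ₗ[ℝ] ℝ :=
    { toFun := fun φ => -∫ x : U, (φ : Euc m → ℝ) x * g x ∂leb U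
      map_add' := fun φ ψ => by
        rw [← neg_add, ← integral_add (hint φ) (hint ψ)]
        simp [add_mul]
      map_smul' := fun c φ => by
        simp [mul_assoc, integral_const_mul] }
  have hfin : C * eLpNorm g m (leb U) ≠ ⊤ := ENNReal.mul_ne_top ENNReal.coe_ne_top hgm.2.ne
  obtain ⟨u, hum, hub, hu⟩ := exists_field_of_abs_le ℓ
    (c := (C * eLpNorm g m (leb U)).toReal) ENNReal.toReal_nonneg fun φ => by
      have h := hC.enorm_integral_mul_le hm hU hg.1 φ
      rw [← toReal_enorm, ← ENNReal.toReal_mul, ← Real.norm_eq_abs, ← toReal_enorm]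
      refine ENNReal.toReal_mono (ENNReal.mul_ne_top hfin enorm_ne_top) ?_
      simpa [ℓ, enorm_neg] using h
  have hle : eLpNorm (fun x : U => u x) ⊤ (leb U) ≤ C * eLpNorm g m (leb U) := by
    have h := (MeasurableEmbedding.subtype_coe hU).eLpNorm_map_measure (μ := leb U)
      (g := u) (p := ⊤)
    rw [map_coe_leb hU] at h
    refine h.symm.trans_le ((eLpNorm_restrict_le _ _ _ _).trans ?_)
    rw [eLpNorm_exponent_top]
    refine eLpNormEssSup_le_of_ae_enorm_bound ?_
    filter_upwards [hub] with x hx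
    rw [← ofReal_norm]
    exact ENNReal.ofReal_le_of_le_toReal hx
  refine ⟨fun x => u x, ⟨⟨(hum.comp_measurable measurable_subtype_coe).aestronglyMeasurable,
    hle.trans_lt hfin.lt_top⟩, fun φ hφ hφc hφU => ?_⟩, hle⟩
  obtain ⟨B, hB⟩ := hφc.exists_bound_of_continuous hφ.continuous
  rw [integral_withDensityᵥ (f := fun x : U => φ x) hg
      (hφ.continuous.comp continuous_subtype_val).aestronglyMeasurable (fun x => hB x),
    integral_coe_leb hU fun x => inner ℝ (u x) (gradient φ x),
    setIntegral_eq_integral_of_forall_compl_eq_zero]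
  · exact hu ⟨φ, hφ, hφc⟩
  · intro x hx
    rw [gradient_eq_zero_of_notMem_tsupport fun h => hx (hφU h), inner_zero_right]

/-- The pairing of `f` with any divergence is controlled by the bounded fluctuation seminorm and
the norm of the field. -/
lemma ofReal_integral_le_mul_bfSeminorm {f : U → ℝ} {u : U → Euc m} {ν : SignedMeasure U}
    (hu : IsDivMeasureField U u ν) {t : ℝ} (ht : 0 < t)
    (hut : eLpNorm u ⊤ (leb U) ≤ ENNReal.ofReal t) :
    ENNReal.ofReal (∫ᵛ x, f x ∂•ν) ≤ ENNReal.ofReal t * bfSeminorm U f := by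
  have h1 : IsDivMeasureField U (t⁻¹ • u) (t⁻¹ • ν) := by
    refine ⟨hu.memLp.const_smul _, fun φ hφ hφc hφU => ?_⟩
    rw [VectorMeasure.integral_smul_vectorMeasure, smul_eq_mul, ← mul_neg,
      ← hu.divergence φ hφ hφc hφU, ← integral_const_mul]
    simp
  have h2 : eLpNorm (t⁻¹ • u) ⊤ (leb U) ≤ 1 := by
    rw [eLpNorm_const_smul]
    refine (mul_le_mul_right hut _).trans ?_
    rw [← ofReal_norm, ← ENNReal.ofReal_mul (norm_nonneg _), Real.norm_of_nonneg (by positivity),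
      inv_mul_cancel₀ ht.ne', ENNReal.ofReal_one]
  have h3 : ENNReal.ofReal (∫ᵛ x, f x ∂•(t⁻¹ • ν)) ≤ bfSeminorm U f :=
    le_iSup₂_of_le _ _ (le_iSup₂_of_le h1 h2 le_rfl)
  rw [VectorMeasure.integral_smul_vectorMeasure, smul_eq_mul,
    ENNReal.ofReal_mul (by positivity)] at h3
  calc ENNReal.ofReal (∫ᵛ x, f x ∂•ν)
      = ENNReal.ofReal t * (ENNReal.ofReal t⁻¹ * ENNReal.ofReal (∫ᵛ x, f x ∂•ν)) := by
        rw [← mul_assoc, ← ENNReal.ofReal_mul ht.le, mul_inv_cancel₀ ht.ne', ENNReal.ofReal_one,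
          one_mul]
    _ ≤ _ := by gcongr

/-- `∫_U f g ≤ C ‖g‖_m ‖f‖_BF` for every integrable `g ∈ L_m(U)` and every admissible Sobolev
constant `C`. -/
lemma IsSobolevConstant.ofReal_integral_mul_le {C : ℝ≥0} (hC : IsSobolevConstant m C)
    (hm : 1 ≤ m) (hU : MeasurableSet U) {f : U → ℝ} (hf : HasBoundedFluctuation U f) {g : U → ℝ}
    (hg : Integrable g (leb U)) (hgm : MemLp g m (leb U)) :
    ENNReal.ofReal (∫ x, f x * g x ∂leb U) ≤
      C * bfSeminorm U f * eLpNorm g m (leb U) := by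
  obtain ⟨B, hB⟩ := hf.bounded
  obtain ⟨u, hu, hub⟩ := hC.exists_isDivMeasureField hm hU hg hgm
  rw [← integral_withDensityᵥ hg
    (aestronglyMeasurable_of_measurable_suslinCompletion hU hf.measurable) hB]
  have hfin : C * eLpNorm g m (leb U) ≠ ⊤ := ENNReal.mul_ne_top ENNReal.coe_ne_top hgm.2.ne
  -- the field is scaled by any number above its norm, which may vanish
  have h1 (ε : ℝ≥0) (hε : 0 < ε) : ENNReal.ofReal (∫ᵛ x, f x ∂•(leb U).withDensityᵥ g) ≤
      (C * eLpNorm g m (leb U) + ε) * bfSeminorm U f := by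
    have ht : ENNReal.ofReal (C * eLpNorm g m (leb U) + ε).toReal =
        C * eLpNorm g m (leb U) + ε := ENNReal.ofReal_toReal (by finiteness)
    rw [← ht]
    refine ofReal_integral_le_mul_bfSeminorm hu (ENNReal.toReal_pos ?_ (by finiteness)) ?_
    · simp [hε.ne']
    · rw [ht]
      exact hub.trans le_self_add
  have h2 : Tendsto (fun ε : ℝ≥0 => (C * eLpNorm g m (leb U) + ε) * bfSeminorm U f) (𝓝[>] 0)
      (𝓝 ((C * eLpNorm g m (leb U) + (0 : ℝ≥0)) * bfSeminorm U f)) := by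
    refine ENNReal.Tendsto.mul_const ?_ (.inr hf.finite.ne)
    exact (tendsto_const_nhds.add (ENNReal.continuous_coe.tendsto 0)).mono_left nhdsWithin_le_nhds
  refine (ge_of_tendsto h2 (eventually_mem_nhdsWithin.mono fun ε hε => h1 ε hε)).trans_eq ?_
  rw [ENNReal.coe_zero, add_zero]
  ring

/-! ### The converse of Hölder's inequality -/

section ConverseHolder

variable {X : Type*} {f : X → ℝ}

/-- The function `sign f · |f|^(r - 1)` on the set `s`: the extremal function in Hölder's
inequality. The value `0 ^ (r - 2)` is irrelevant because it is multiplied by `0`. -/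
noncomputable def holderExtremal (s : Set X) (f : X → ℝ) (r : ℝ) : X → ℝ :=
  s.indicator fun x => |f x| ^ (r - 2) * f x

lemma abs_rpow_sub_two_mul_abs {r a : ℝ} (ha : a ≠ 0) : |a| ^ (r - 2) * |a| = |a| ^ (r - 1) := by
  rw [← Real.rpow_add_one (abs_ne_zero.2 ha)]
  ring_nf

lemma abs_holderExtremal_le {C r : ℝ} (hr : 1 ≤ r) (hC : ∀ x, |f x| ≤ C) (s : Set X) (x : X) :
    |holderExtremal s f r x| ≤ s.indicator (fun _ => C ^ (r - 1)) x := by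
  by_cases hx : x ∈ s
  · simp only [holderExtremal, indicator_of_mem hx]
    rcases eq_or_ne (f x) 0 with h | h
    · rw [h, mul_zero, abs_zero]
      have := (abs_nonneg _).trans (hC x)
      positivity
    · rw [abs_mul, abs_of_nonneg (by positivity), abs_rpow_sub_two_mul_abs h]
      exact Real.rpow_le_rpow (abs_nonneg _) (hC x) (by linarith)
  · simp [holderExtremal, hx]

lemma mul_holderExtremal {r : ℝ} (hr : r ≠ 0) (s : Set X) (x : X) :
    f x * holderExtremal s f r x = s.indicator (fun x => |f x| ^ r) x := by
  by_cases hx : x ∈ s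
  · simp only [holderExtremal, indicator_of_mem hx]
    rcases eq_or_ne (f x) 0 with h | h
    · simp [h, Real.zero_rpow hr]
    · rw [mul_left_comm, ← abs_mul_abs_self, ← mul_assoc, abs_rpow_sub_two_mul_abs h,
        ← Real.rpow_add_one (abs_ne_zero.2 h), sub_add_cancel]
  · simp [holderExtremal, hx]

variable [MeasurableSpace X] {μ : Measure X} {K : ℝ≥0∞} {p q : ℝ≥0∞}

lemma aestronglyMeasurable_holderExtremal (hf : AEStronglyMeasurable f μ) {s : Set X}
    (hs : MeasurableSet s) (r : ℝ) : AEStronglyMeasurable (holderExtremal s f r) μ :=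
  AEStronglyMeasurable.indicator
    ((hf.aemeasurable.abs.pow_const _).mul hf.aemeasurable).aestronglyMeasurable hs

lemma memLp_holderExtremal (hf : AEStronglyMeasurable f μ) {C r : ℝ} (hr : 1 ≤ r)
    (hC : ∀ x, |f x| ≤ C) {s : Set X} (hs : MeasurableSet s) (hμs : μ s ≠ ⊤) (p : ℝ≥0∞) :
    MemLp (holderExtremal s f r) p μ := by
  refine (memLp_indicator_const p hs (C ^ (r - 1)) (.inr hμs)).mono
    (aestronglyMeasurable_holderExtremal hf hs r) (.of_forall fun x => ?_)
  exact (abs_holderExtremal_le hr hC s x).trans (le_abs_self _)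

lemma ofReal_integral_mul_holderExtremal (hf : AEStronglyMeasurable f μ) {C r : ℝ} (hr : 1 ≤ r)
    (hC : ∀ x, |f x| ≤ C) {s : Set X} (hs : MeasurableSet s) (hμs : μ s ≠ ⊤) :
    ENNReal.ofReal (∫ x, f x * holderExtremal s f r x ∂μ) = ∫⁻ x in s, ‖f x‖ₑ ^ r ∂μ := by
  have hint : Integrable (fun x => f x * holderExtremal s f r x) μ :=
    (memLp_one_iff_integrable.1 (memLp_holderExtremal hf hr hC hs hμs 1)).bdd_mul hf
      (.of_forall hC)
  simp only [mul_holderExtremal (by linarith : r ≠ 0) s] at hint ⊢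
  rw [ofReal_integral_eq_lintegral_ofReal hint
    (.of_forall fun x => indicator_nonneg (fun _ _ => by positivity) _), ← lintegral_indicator hs]
  refine lintegral_congr fun x => ?_
  by_cases hx : x ∈ s
  · simp only [indicator_of_mem hx]
    rw [← ofReal_norm, Real.norm_eq_abs, ENNReal.ofReal_rpow_of_nonneg (abs_nonneg _) (by linarith)]
  · simp [hx]

/-- A bounded measurable function belongs to `L_∞` with norm at most `K` if it pairs with
integrable functions `g` to at most `K ‖g‖₁`. -/
lemma eLpNorm_top_le_of_forall_integral_mul_le [SigmaFinite μ] (hf : AEStronglyMeasurable f μ)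
    {C : ℝ} (hC : ∀ x, |f x| ≤ C)
    (hK : ∀ g : X → ℝ, Integrable g μ →
      ENNReal.ofReal (∫ x, f x * g x ∂μ) ≤ K * eLpNorm g 1 μ) :
    eLpNorm f ⊤ μ ≤ K := by
  rw [eLpNorm_exponent_top]
  refine eLpNormEssSup_le_of_ae_enorm_bound ?_
  refine ae_le_of_forall_setLIntegral_le_of_sigmaFinite₀ hf.enorm fun s hs hμs => ?_
  have h := hK _ (memLp_one_iff_integrable.1 (memLp_holderExtremal hf le_rfl hC hs hμs.ne 1))
  rw [ofReal_integral_mul_holderExtremal hf le_rfl hC hs hμs.ne] at h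
  simp only [ENNReal.rpow_one] at h
  rw [setLIntegral_const]
  refine h.trans (mul_le_mul_right ?_ _)
  rw [eLpNorm_one_eq_lintegral_enorm, ← lintegral_indicator_one hs]
  refine lintegral_mono fun x => ?_
  have hx := abs_holderExtremal_le le_rfl hC s x
  rw [← ofReal_norm, Real.norm_eq_abs]
  refine (ENNReal.ofReal_le_ofReal hx).trans ?_
  by_cases hxs : x ∈ s <;> simp [hxs]

/-- Converse of Hölder's inequality for bounded functions and finite exponents. -/
lemma eLpNorm_le_of_forall_integral_mul_le_of_real [SigmaFinite μ]
    (hf : AEStronglyMeasurable f μ) {C : ℝ} (hC : ∀ x, |f x| ≤ C) {p q : ℝ}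
    (hpq : p.HolderConjugate q)
    (hK : ∀ g : X → ℝ, Integrable g μ → MemLp g (ENNReal.ofReal q) μ →
      ENNReal.ofReal (∫ x, f x * g x ∂μ) ≤ K * eLpNorm g (ENNReal.ofReal q) μ) :
    eLpNorm f (ENNReal.ofReal p) μ ≤ K := by
  have hp := hpq.pos
  have hq := hpq.symm.pos
  rw [eLpNorm_eq_lintegral_rpow_enorm_toReal (by simpa using hp) ENNReal.ofReal_ne_top,
    ENNReal.toReal_ofReal hp.le, one_div, ENNReal.rpow_inv_le_iff hp]
  refine lintegral_le_of_forall_fin_meas_le _ fun s hs hμs => ?_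
  have h := hK _ (memLp_one_iff_integrable.1 (memLp_holderExtremal hf hpq.lt.le hC hs hμs 1))
    (memLp_holderExtremal hf hpq.lt.le hC hs hμs _)
  rw [ofReal_integral_mul_holderExtremal hf hpq.lt.le hC hs hμs,
    eLpNorm_eq_lintegral_rpow_enorm_toReal (by simpa using hq) ENNReal.ofReal_ne_top,
    ENNReal.toReal_ofReal hq.le] at h
  -- `|g|^q = |f|^p` on `s` for the extremal function `g`, since `(p - 1) q = p`
  have h1 : ∫⁻ x, ‖holderExtremal s f p x‖ₑ ^ q ∂μ = ∫⁻ x in s, ‖f x‖ₑ ^ p ∂μ := by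
    rw [← lintegral_indicator hs]
    refine lintegral_congr fun x => ?_
    by_cases hx : x ∈ s
    · simp only [holderExtremal, indicator_of_mem hx]
      rcases eq_or_ne (f x) 0 with h | h
      · simp [h, hp, hq]
      · rw [← ofReal_norm, ← ofReal_norm, Real.norm_eq_abs, Real.norm_eq_abs, abs_mul,
          abs_of_nonneg (a := |f x| ^ (p - 2)) (by positivity), abs_rpow_sub_two_mul_abs h,
          ENNReal.ofReal_rpow_of_nonneg (by positivity) hq.le,
          ENNReal.ofReal_rpow_of_nonneg (by positivity) hp.le, ← Real.rpow_mul (abs_nonneg _),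
          hpq.sub_one_mul_conj]
    · simp [holderExtremal, hx, hq]
  rw [h1] at h
  set I := ∫⁻ x in s, ‖f x‖ₑ ^ p ∂μ
  have hI : I ≠ ⊤ := by
    rw [show I = _ from (ofReal_integral_mul_holderExtremal hf hpq.lt.le hC hs hμs).symm]
    exact ENNReal.ofReal_ne_top
  rcases eq_or_ne I 0 with h0 | h0
  · rw [h0]
    exact zero_le
  rw [← ENNReal.rpow_inv_le_iff hp]
  have h2 : I ^ p⁻¹ * I ^ (1 / q) = I := by
    rw [← ENNReal.rpow_add _ _ h0 hI, one_div, hpq.inv_add_inv_eq_one, ENNReal.rpow_one]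
  have h3 : I ^ (1 / q) ≠ 0 := by simp [h0, hI]
  have h4 : I ^ (1 / q) ≠ ⊤ := ENNReal.rpow_ne_top_of_nonneg (by positivity) hI
  rw [← ENNReal.mul_le_mul_iff_left h3 h4, h2]
  exact h

/-- Converse of Hölder's inequality for bounded functions: a bounded function that pairs with
all `g ∈ L₁ ∩ L_q` to at most `K ‖g‖_q` has `L_p` norm at most `K`. -/
lemma eLpNorm_le_of_forall_integral_mul_le [SigmaFinite μ] (hpq : p.HolderConjugate q)
    (hq : q ≠ ⊤) (hf : AEStronglyMeasurable f μ) {C : ℝ} (hC : ∀ x, |f x| ≤ C)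
    (hK : ∀ g : X → ℝ, Integrable g μ → MemLp g q μ →
      ENNReal.ofReal (∫ x, f x * g x ∂μ) ≤ K * eLpNorm g q μ) :
    eLpNorm f p μ ≤ K := by
  rcases eq_or_ne p ⊤ with rfl | hp
  · obtain rfl : q = 1 := by
      simpa using (ENNReal.holderConjugate_iff.1 hpq)
    exact eLpNorm_top_le_of_forall_integral_mul_le hf hC fun g hg =>
      hK g hg (memLp_one_iff_integrable.2 hg)
  · have hpq' : p.toReal.HolderConjugate q.toReal := ENNReal.HolderConjugate.toReal_of_ne_top hp hq
    rw [← ENNReal.ofReal_toReal hp]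
    rw [← ENNReal.ofReal_toReal hq] at hK
    exact eLpNorm_le_of_forall_integral_mul_le_of_real hf hC hpq' hK

end ConverseHolder

end BoundedFluct

theorem mainTheorem7 (m : ℕ) (hm : 1 ≤ m) (U : Set (BoundedFluct.Euc m)) (hU : IsOpen U)
    (f : U → ℝ) (hf : BoundedFluct.HasBoundedFluctuation U f) :
    MemLp f (BoundedFluct.sobolevExponent m) (BoundedFluct.leb U) ∧
      eLpNorm f (BoundedFluct.sobolevExponent m) (BoundedFluct.leb U) ≤
        (BoundedFluct.optimalSobolevConstant m : ℝ≥0∞) * BoundedFluct.bfSeminorm U f := by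
  have hsm := BoundedFluct.aestronglyMeasurable_of_measurable_suslinCompletion hU.measurableSet
    hf.measurable
  have := BoundedFluct.sigmaFinite_leb hU.measurableSet
  obtain ⟨C, hC⟩ := hf.bounded
  have hle := BoundedFluct.eLpNorm_le_of_forall_integral_mul_le
    (BoundedFluct.holderConjugate_sobolevExponent hm) (ENNReal.natCast_ne_top m) hsm hC
    fun g hg hgm =>
      (BoundedFluct.isSobolevConstant_optimalSobolevConstant hm).ofReal_integral_mul_le
        hm hU.measurableSet hf hg hgm
  exact ⟨⟨hsm, hle.trans_lt (ENNReal.mul_lt_top ENNReal.coe_lt_top hf.finite)⟩, hle⟩
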